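/- A \emph{modal Kripke frame} is a partially ordered set $(W,\sqsubseteq)$ with a \emph{bimodule} $R$ on $W$, i.e. a relation $R\subseteq W\times W$ such that $w'\sqsubseteq w$, $w\mathrel R v$ and $v\sqsubseteq v'$ imply $w'\mathrel R v'$. Let $\mathbf{EBimod}$ be the category of modal Kripke frames and monotone maps $f:W\to W'$ such that $w\mathrel R v$ implies $f(w)\mathrel{R'}f(v)$. Such an $f$ is \emph{open} if $f(w)\sqsubseteq v'$ implies that there is $w'\sqsupseteq w$ with $f(w')=v'$, and \emph{modally open} if $f(w)\mathrel{R'}v$ implies that there is $w'$ with $w\mathrel R w'$ and $f(w')\sqsubseteq v$. An element $d$ of a complete lattice $L$ is \emph{prime} if $d\sqsubseteq\bigsqcup X$ implies $d\sqsubseteq x$ for some $x\in X$, for all $X\subseteq L$; and $L$ is \emph{prime algebraic} if every $d\in L$ is the supremum of the primes below it. (Such an $L$ is a complete Heyting algebra.) Let $\mathbf{PrAlgLattO}$ be the category of pairs $(L,\Box_L)$ of a prime algebraic lattice $L$ and a map $\Box_L:L\to L$ that preserves all meets; its morphisms are the maps $h:L\to L'$ that preserve all joins and all meets and satisfy $h(\Box_L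 x)\sqsubseteq\Box_{L'}h(x)$ for all $x$. Sending $(W,\sqsubseteq,R)$ to the lattice $[W,\mathbb 2]$ of upper sets of $W$ (monotone maps from $W$ to $\mathbb 2=\{0\sqsubseteq 1\}$) with $\Box_R(S)=\{w\mid \forall v.\ w\mathrel R v\Rightarrow v\in S\}$, and $f$ to $f^*(S)=S\circ f$, defines a functor $\mathbf{EBimod}^{\mathrm{op}}\to\mathbf{PrAlgLattO}$. This functor is an equivalence, and it restricts to equivalences between wide subcategories $$\mathbf{EBimod}^{\mathrm{op}}_{\mathrm{moo}}\simeq\mathbf{PrAlgLattO}_{\Rightarrow o},\qquad \mathbf{EBimod}^{\mathrm{op}}_{\mathrm{moo,surj}}\simeq\mathbf{PrAlgLattO}_{\Rightarrow o,\mathrm{inj}},$$ where the morphisms on the left are the open and modally open (resp. open, modally open and surjective) morphisms, and those on the right are the morphisms that preserve exponentials (Heyting implication) and satisfy $h(\Box_L x)=\Box_{L'}h(x)$ for all $x$ (resp. and are injective). -/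

import Mathlib

open CategoryTheory

universe u

namespace ModalDuality

/-! ## Prime algebraic lattices -/

/-- An element `d` of a complete lattice is prime if whenever it lies below a supremum
`sSup X`, it lies below some element of `X`. -/
def IsPrimeElement {L : Type u} [CompleteLattice L] (d : L) : Prop :=
  ∀ X : Set L, d ≤ sSup X → ∃ x ∈ X, d ≤ x

/-- A complete lattice is prime algebraic if every element is the supremum of the prime
elements below it. -/
def IsPrimeAlgebraic (L : Type u) [CompleteLattice L] : Prop :=
  ∀ d : L, d = sSup {p : L | p ≤ d ∧ IsPrimeElement p}

/-- `e` is the exponential (Heyting implication) of `a` and `b`. -/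
def IsExponential {L : Type u} [CompleteLattice L] (a b e : L) : Prop :=
  ∀ c : L, c ⊓ a ≤ b ↔ c ≤ e

/-- In a prime algebraic lattice any two elements have a unique exponential. -/
theorem IsPrimeAlgebraic.existsUnique_isExponential {L : Type u} [CompleteLattice L]
    (hL : IsPrimeAlgebraic L) (a b : L) : ∃! e : L, IsExponential a b e := by
  refine ⟨sSup {c | c ⊓ a ≤ b}, fun c => ⟨fun h => le_sSup h, fun h => ?_⟩, fun e he => ?_⟩
  · rw [hL (c ⊓ a)]
    refine sSup_le ?_
    rintro p ⟨hp, hpp⟩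
    obtain ⟨x, hx, hpx⟩ := hpp _ ((hp.trans inf_le_left).trans h)
    exact (le_inf hpx (hp.trans inf_le_right)).trans hx
  · apply le_antisymm
    · exact le_sSup ((he e).2 le_rfl)
    · exact sSup_le fun c hc => (he c).1 hc

/-! ## Modal Kripke frames -/

/-- A modal Kripke frame: a partially ordered set with a bimodule from it to itself, that is
a relation which is contravariant in its first and covariant in its second argument. -/
structure EBimod : Type (u + 1) where
  carrier : Type u
  [order : PartialOrder carrier]
  rel : carrier → carrier → Prop
  rel_of_le : ∀ {w' w v v' : carrier}, w' ≤ w → rel w v → v ≤ v' → rel w' v'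

attribute [instance] EBimod.order

namespace EBimod

/-- A morphism of endo-bimodules: a monotone map which preserves the relation. -/
@[ext]
structure Hom (W W' : EBimod.{u}) : Type u where
  toFun : W.carrier →o W'.carrier
  map_rel : ∀ {w v : W.carrier}, W.rel w v → W'.rel (toFun w) (toFun v)

instance : Category EBimod.{u} where
  Hom := Hom
  id W := ⟨OrderHom.id, fun h => h⟩
  comp f g := ⟨g.toFun.comp f.toFun, fun h => g.map_rel (f.map_rel h)⟩

/-- `f` is open: if `f w ≤ v'` then `f w' = v'` for some `w' ≥ w`. -/
def IsOpen {W W' : EBimod.{u}} (f : W ⟶ W') : Prop :=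
  ∀ (w : W.carrier) (v' : W'.carrier), f.toFun w ≤ v' →
    ∃ w' : W.carrier, w ≤ w' ∧ f.toFun w' = v'

/-- `f` is modally open: if `R' (f w) v` then `R w w'` and `f w' ≤ v` for some `w'`. -/
def IsModallyOpen {W W' : EBimod.{u}} (f : W ⟶ W') : Prop :=
  ∀ (w : W.carrier) (v : W'.carrier), W'.rel (f.toFun w) v →
    ∃ w' : W.carrier, W.rel w w' ∧ f.toFun w' ≤ v

/-- The open and modally open morphisms. -/
def moo : MorphismProperty EBimod.{u} := fun _ _ f => IsOpen f ∧ IsModallyOpen f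

/-- The open, modally open and surjective morphisms. -/
def mooSurj : MorphismProperty EBimod.{u} :=
  fun _ _ f => IsOpen f ∧ IsModallyOpen f ∧ Function.Surjective f.toFun

theorem IsOpen.id (W : EBimod.{u}) : IsOpen (𝟙 W) := fun _ v' h => ⟨v', h, rfl⟩

theorem IsModallyOpen.id (W : EBimod.{u}) : IsModallyOpen (𝟙 W) := fun _ v h => ⟨v, h, le_rfl⟩

theorem IsOpen.comp {W W' W'' : EBimod.{u}} {f : W ⟶ W'} {g : W' ⟶ W''}
    (hf : IsOpen f) (hg : IsOpen g) : IsOpen (f ≫ g) := by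
  intro w v h
  obtain ⟨v', hv', rfl⟩ := hg (f.toFun w) v h
  obtain ⟨w', hw', rfl⟩ := hf w v' hv'
  exact ⟨w', hw', rfl⟩

theorem IsModallyOpen.comp {W W' W'' : EBimod.{u}} {f : W ⟶ W'} {g : W' ⟶ W''}
    (hf : IsModallyOpen f) (hg : IsModallyOpen g) : IsModallyOpen (f ≫ g) := by
  intro w v h
  obtain ⟨v', hv', hle⟩ := hg (f.toFun w) v h
  obtain ⟨w', hw', hle'⟩ := hf w v' hv'
  exact ⟨w', hw', (g.toFun.monotone hle').trans hle⟩

instance : moo.{u}.IsMultiplicative where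
  id_mem W := ⟨IsOpen.id W, IsModallyOpen.id W⟩
  comp_mem _ _ hf hg := ⟨hf.1.comp hg.1, hf.2.comp hg.2⟩

instance : mooSurj.{u}.IsMultiplicative where
  id_mem W := ⟨IsOpen.id W, IsModallyOpen.id W, fun x => ⟨x, rfl⟩⟩
  comp_mem _ _ hf hg := ⟨hf.1.comp hg.1, hf.2.1.comp hg.2.1, hg.2.2.comp hf.2.2⟩

end EBimod

/-! ## Prime algebraic lattices with an operator -/

/-- A prime algebraic lattice with an operator `box` that preserves all meets. -/
structure PrAlgLattO : Type (u + 1) where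
  carrier : Type u
  [lattice : CompleteLattice carrier]
  primeAlgebraic : IsPrimeAlgebraic carrier
  box : sInfHom carrier carrier

attribute [instance] PrAlgLattO.lattice

namespace PrAlgLattO

/-- A morphism: a complete lattice homomorphism (it preserves all joins and all meets) `h` with
`h (box x) ≤ box (h x)`. -/
@[ext]
structure Hom (L L' : PrAlgLattO.{u}) : Type u where
  toFun : CompleteLatticeHom L.carrier L'.carrier
  map_box_le : ∀ x : L.carrier, toFun (L.box x) ≤ L'.box (toFun x)

instance : Category PrAlgLattO.{u} where
  Hom := Hom
  id L := ⟨CompleteLatticeHom.id L.carrier, fun _ => le_rfl⟩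
  comp {_ _ L''} f g := ⟨g.toFun.comp f.toFun, fun x =>
    (OrderHomClass.mono g.toFun (f.map_box_le x)).trans (g.map_box_le (f.toFun x))⟩

/-- `h` preserves exponentials. -/
def PreservesExponentials {L L' : PrAlgLattO.{u}} (h : L ⟶ L') : Prop :=
  ∀ a b e : L.carrier, IsExponential a b e →
    IsExponential (h.toFun a) (h.toFun b) (h.toFun e)

/-- `h` commutes with the operators. -/
def CommutesWithBox {L L' : PrAlgLattO.{u}} (h : L ⟶ L') : Prop :=
  ∀ x : L.carrier, h.toFun (L.box x) = L'.box (h.toFun x)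

/-- The complete Heyting homomorphisms that commute with the operators. -/
def heyt : MorphismProperty PrAlgLattO.{u} :=
  fun _ _ h => PreservesExponentials h ∧ CommutesWithBox h

/-- The injective complete Heyting homomorphisms that commute with the operators. -/
def heytInj : MorphismProperty PrAlgLattO.{u} :=
  fun _ _ h => PreservesExponentials h ∧ CommutesWithBox h ∧ Function.Injective h.toFun

theorem CommutesWithBox.comp {L L' L'' : PrAlgLattO.{u}} {g : L ⟶ L'} {h : L' ⟶ L''}
    (hg : CommutesWithBox g) (hh : CommutesWithBox h) : CommutesWithBox (g ≫ h) := fun x =>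
  (congrArg h.toFun (hg x)).trans (hh (g.toFun x))

instance : heyt.{u}.IsMultiplicative where
  id_mem _ := ⟨fun _ _ _ h => h, fun _ => rfl⟩
  comp_mem _ _ hg hh :=
    ⟨fun _ _ _ he => hh.1 _ _ _ (hg.1 _ _ _ he), hg.2.comp hh.2⟩

instance : heytInj.{u}.IsMultiplicative where
  id_mem _ := ⟨fun _ _ _ h => h, fun _ => rfl, fun _ _ h => h⟩
  comp_mem _ _ hg hh :=
    ⟨fun _ _ _ he => hh.1 _ _ _ (hg.1 _ _ _ he), hg.2.1.comp hh.2.1, hh.2.2.comp hg.2.2⟩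

end PrAlgLattO

/-! ## The complex algebra functor -/

/-- `W →o Prop` (with `False ≤ True`) is the poset of monotone maps from `W` to the two-element
chain, i.e. of upper sets of `W` ordered by inclusion. It is prime algebraic. -/
theorem isPrimeAlgebraic_orderHom (W : Type u) [PartialOrder W] :
    IsPrimeAlgebraic (W →o Prop) := by
  intro S
  apply le_antisymm
  · intro w hw
    let P : W →o Prop := ⟨fun v => w ≤ v, fun _ _ h hw => hw.trans h⟩
    have hP : P ≤ sSup {p : W →o Prop | p ≤ S ∧ IsPrimeElement p} := by
      refine le_sSup ⟨fun v hv => S.monotone hv hw, fun X hX => ?_⟩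
      have h1 : (sSup X : W →o Prop) w := hX w (le_refl w)
      simp only [OrderHom.sSup_apply, iSup_Prop_eq] at h1
      obtain ⟨x, hx, hxw⟩ := h1
      exact ⟨x, hx, fun v hv => x.monotone hv hxw⟩
    exact hP w (le_refl w)
  · exact sSup_le fun p hp => hp.1

/-- The operator of a bimodule: `w ∈ □ S` iff every `v` with `R w v` is in `S`. -/
def boxOp (W : EBimod.{u}) : sInfHom (W.carrier →o Prop) (W.carrier →o Prop) where
  toFun S := ⟨fun w => ∀ v, W.rel w v → S v,
    fun _ _ hw h v hv => h v (W.rel_of_le hw hv le_rfl)⟩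
  map_sInf' X := by
    ext w
    simp only [sInf_image, OrderHom.iInf_apply, OrderHom.sInf_apply, OrderHom.coe_mk,
      iInf_Prop_eq]
    exact ⟨fun h S hS v hv => h v hv S hS, fun h v hv S hS => h S hS v hv⟩

/-- Precomposition with a monotone map, `S ↦ S ∘ f`, as a complete lattice homomorphism. -/
def precomp {W W' : Type u} [PartialOrder W] [PartialOrder W'] (f : W →o W') :
    CompleteLatticeHom (W' →o Prop) (W →o Prop) where
  toFun S := S.comp f
  map_sInf' X := by
    ext w
    simp [OrderHom.sInf_apply]
  map_sSup' X := by
    ext w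
    simp [OrderHom.sSup_apply]

/-- The contravariant functor that sends a modal Kripke frame `W` to its lattice of upper sets
with the operator `□`, and a morphism `f` to the map `S ↦ S ∘ f`. -/
def complexAlgebra : EBimod.{u}ᵒᵖ ⥤ PrAlgLattO.{u} where
  obj W :=
    { carrier := W.unop.carrier →o Prop
      primeAlgebraic := isPrimeAlgebraic_orderHom W.unop.carrier
      box := boxOp W.unop }
  map f := ⟨precomp f.unop.toFun, fun _ _ h v hv => h (f.unop.toFun v) (f.unop.map_rel hv)⟩

end ModalDuality

/-! This is discrete duality: a frame is recovered from its upper sets because its points are the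
principal upper sets, which are the primes of that lattice. A complete lattice homomorphism between
lattices of upper sets is at each point `w` evaluation at a point `φ w`
(`exists_forall_completeLatticeHom_iff`), so it is precomposition with `φ`; the lax box inequality
says that `φ` preserves the relation. This gives fullness. Conversely, a prime algebraic lattice is
the lattice of upper sets of its primes in the reversed order (`primesBelowIso`), and a
meet-preserving box is the box of a relation on primes (`primesBelow_box`). The restricted
equivalences follow because each condition on `f` matches one on `f^*`, tested on upper sets
attached to a single point, and because isomorphisms satisfy the conditions on the lattice side. -/

open CategoryTheory Opposite

/-! ### Restricting a contravariant equivalence to wide subcategories -/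

namespace CategoryTheory

universe v₁ v₂ u₁ u₂

/-- An equivalence `F : Cᵒᵖ ⥤ D` restricts to an equivalence between the wide subcategories of
two morphism properties which correspond under `F`, if the one on `D` contains the
isomorphisms. -/
theorem exists_wideSubcategory_equivalence {C : Type u₁} [Category.{v₁} C] {D : Type u₂}
    [Category.{v₂} D] (F : Cᵒᵖ ⥤ D) [F.IsEquivalence]
    (P : MorphismProperty C) [P.IsMultiplicative] (Q : MorphismProperty D) [Q.IsMultiplicative]
    (hPQ : ∀ {X Y : C} (f : X ⟶ Y), Q (F.map f.op) ↔ P f)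
    (hQ : ∀ {X Y : D} (e : X ≅ Y), Q e.hom) :
    ∃ E : (WideSubcategory P)ᵒᵖ ≌ WideSubcategory Q,
      E.functor ⋙ wideSubcategoryInclusion Q = (wideSubcategoryInclusion P).op ⋙ F := by
  let G : (WideSubcategory P)ᵒᵖ ⥤ WideSubcategory Q :=
    { obj := fun X => ⟨F.obj (op X.unop.obj)⟩
      map := fun f => ⟨F.map f.unop.hom.op, (hPQ _).2 f.unop.property⟩
      map_id := fun X => WideSubcategory.hom_ext _ (F.map_id _)
      map_comp := fun f g => WideSubcategory.hom_ext _ (F.map_comp f.unop.hom.op g.unop.hom.op) }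
  have : G.Faithful := ⟨fun {X Y f g} h => by
    have h' : F.map f.unop.hom.op = F.map g.unop.hom.op :=
      congrArg InducedWideCategory.Hom.hom h
    exact Quiver.Hom.unop_inj
      (WideSubcategory.hom_ext _ (Quiver.Hom.op_inj (F.map_injective h')))⟩
  have : G.Full := ⟨fun {X Y} g => by
    obtain ⟨f, hf⟩ := F.map_surjective g.hom
    have hfP : P f.unop := (hPQ _).1 (by simpa [hf] using g.property)
    let f' : Y.unop ⟶ X.unop := ⟨f.unop, hfP⟩
    exact ⟨f'.op, WideSubcategory.hom_ext _ hf⟩⟩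
  -- `hQ` is needed here: the isomorphism given by `F` and its inverse must both lie in `Q`.
  have : G.EssSurj := ⟨fun Y =>
    ⟨op ⟨(F.objPreimage Y.obj).unop⟩,
      ⟨WideSubcategory.isoMk (F.objObjPreimageIso Y.obj) (hQ _)
        (hQ (F.objObjPreimageIso Y.obj).symm)⟩⟩⟩
  have : G.IsEquivalence := {}
  exact ⟨G.asEquivalence, rfl⟩

end CategoryTheory

namespace ModalDuality

/-! ## Principal upper sets -/

/-- The principal upper set of an element. -/
def principal {W : Type u} [PartialOrder W] (w : W) : W →o Prop :=
  ⟨fun v => w ≤ v, fun _ _ h hw => hw.trans h⟩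

theorem principal_le_iff {W : Type u} [PartialOrder W] {w : W} {S : W →o Prop} :
    principal w ≤ S ↔ S w :=
  ⟨fun h => h w (le_refl w), fun h _ hv => S.monotone hv h⟩

/-- The upper set of the elements strictly above an element. -/
def strictPrincipal {W : Type u} [PartialOrder W] (w : W) : W →o Prop :=
  ⟨fun v => w < v, fun _ _ h hw => lt_of_lt_of_le hw h⟩

/-- The upper set of the elements which are not below a given element. -/
def notBelow {W : Type u} [PartialOrder W] (w : W) : W →o Prop :=
  ⟨fun v => ¬ v ≤ w, fun _ _ h hw hv => hw (le_trans h hv)⟩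

theorem orderHom_sSup_iff {W : Type u} [PartialOrder W] (X : Set (W →o Prop)) (w : W) :
    (sSup X : W →o Prop) w ↔ ∃ S ∈ X, S w := by
  simp [OrderHom.sSup_apply]

theorem orderHom_sInf_iff {W : Type u} [PartialOrder W] (X : Set (W →o Prop)) (w : W) :
    (sInf X : W →o Prop) w ↔ ∀ S ∈ X, S w := by
  simp [OrderHom.sInf_apply]

theorem orderHom_congr {W : Type u} [PartialOrder W] {S T : W →o Prop} (h : S = T) (w : W) :
    S w ↔ T w := by
  rw [h]

theorem orderHom_ext {W : Type u} [PartialOrder W] {S T : W →o Prop} (h : ∀ w, S w ↔ T w) :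
    S = T :=
  OrderHom.ext _ _ (funext fun w => propext (h w))

/-- The exponential of two upper sets. -/
theorem isExponential_orderHom_iff {W : Type u} [PartialOrder W] (a b e : W →o Prop) :
    IsExponential a b e ↔ ∀ w, e w ↔ ∀ v, w ≤ v → a v → b v := by
  constructor
  · intro h w
    rw [← principal_le_iff, ← h]
    exact ⟨fun h v hv ha => h v ⟨hv, ha⟩, fun h v hv => h v hv.1 hv.2⟩
  · intro h c
    exact ⟨fun hc w hw => (h w).2 fun v hv ha => hc v ⟨c.monotone hv hw, ha⟩,
      fun hc w hw => (h w).1 (hc w hw.1) w le_rfl hw.2⟩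

/-! ## Correspondence of properties of morphisms -/

section Correspondence

variable {W W' : EBimod.{u}} (f : W ⟶ W')

theorem preservesExponentials_map_iff :
    PrAlgLattO.PreservesExponentials (complexAlgebra.map f.op) ↔ EBimod.IsOpen f := by
  constructor
  · intro h w v' hv'
    by_contra! hne
    -- These two upper sets differ only at `v'`. If `f` misses `v'` above `w`, their preimages agree
    -- there, so `f w` lies in the exponential `e`; but `v'`, which is above `f w`, refutes this.
    obtain ⟨e, he, -⟩ := (isPrimeAlgebraic_orderHom W'.carrier).existsUnique_isExponential
      (principal v') (strictPrincipal v')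
    have hfe := (isExponential_orderHom_iff _ _ _).1 (h _ _ _ he) w
    have hew : e (f.toFun w) := hfe.2 fun v hv hav =>
      lt_of_le_of_ne hav (hne v hv).symm
    exact lt_irrefl v' (((isExponential_orderHom_iff _ _ _).1 he _).1 hew v' hv' (le_refl v'))
  · intro h a b e he
    replace he := (isExponential_orderHom_iff _ _ _).1 he
    refine (isExponential_orderHom_iff _ _ _).2 fun w => ?_
    refine (he (f.toFun w)).trans ⟨fun hw v hv => hw _ (f.toFun.monotone hv), fun hw v' hv' => ?_⟩
    obtain ⟨v, hv, rfl⟩ := h w v' hv'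
    exact hw v hv

theorem commutesWithBox_map_iff :
    PrAlgLattO.CommutesWithBox (complexAlgebra.map f.op) ↔ EBimod.IsModallyOpen f := by
  constructor
  · intro h w v hv
    by_contra! hne
    -- `notBelow v` is the largest upper set that omits `v`.
    have hbox : ∀ v', W'.rel (f.toFun w) v' → ¬ v' ≤ v :=
      (orderHom_congr (h (notBelow v)) w).2 hne
    exact hbox v hv le_rfl
  · intro h S
    refine le_antisymm ((complexAlgebra.map f.op).map_box_le S) fun w hw v hv => ?_
    obtain ⟨w', hw', hle⟩ := h w v hv
    exact S.monotone hle (hw w' hw')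

theorem injective_map_iff :
    Function.Injective (complexAlgebra.map f.op).toFun ↔ Function.Surjective f.toFun := by
  constructor
  · intro h v
    by_contra! hne
    -- The two sets differ only at `v`, so they have the same preimage when `v` is not a value of
    -- `f`.
    have heq : principal v = strictPrincipal v := by
      refine h (orderHom_ext fun w => ?_)
      exact ⟨fun hw => lt_of_le_of_ne hw (hne w).symm, fun hw => le_of_lt hw⟩
    exact lt_irrefl v ((orderHom_congr heq v).1 (le_refl v))
  · intro h S T hST
    refine orderHom_ext fun v => ?_
    obtain ⟨w, rfl⟩ := h v
    exact orderHom_congr hST w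

end Correspondence

/-! ## The complex algebra functor is fully faithful -/

instance : complexAlgebra.{u}.Faithful := by
  refine ⟨fun {X Y f g} h => Quiver.Hom.unop_inj (EBimod.Hom.ext (OrderHom.ext _ _ ?_))⟩
  have key : ∀ w (S : X.unop.carrier →o Prop), S (f.unop.toFun w) ↔ S (g.unop.toFun w) := by
    intro w S
    exact orderHom_congr (DFunLike.congr_fun (congrArg PrAlgLattO.Hom.toFun h) S) w
  funext w
  exact le_antisymm ((key w (principal (f.unop.toFun w))).1 (le_refl _))
    ((key w (principal (g.unop.toFun w))).2 (le_refl _))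

/-- A complete lattice homomorphism between lattices of upper sets is, at each point,
evaluation at some point. -/
theorem exists_forall_completeLatticeHom_iff {W W' : Type u} [PartialOrder W] [PartialOrder W']
    (h : CompleteLatticeHom (W' →o Prop) (W →o Prop)) (w : W) :
    ∃ v : W', ∀ S, h S w ↔ S v := by
  -- Preservation of meets makes `S₀` the least `S` with `w ∈ h S`. Preservation of joins then
  -- yields a `v ∈ S₀` whose principal upper set already has `w` in its image.
  let S₀ : W' →o Prop := sInf {S | h S w}
  have hS₀ : h S₀ w := by
    rw [map_sInf, orderHom_sInf_iff]
    rintro _ ⟨S, hS, rfl⟩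
    exact hS
  have hsup : S₀ = sSup (principal '' {v | S₀ v}) := by
    ext v
    rw [orderHom_sSup_iff]
    constructor
    · exact fun hv => ⟨_, ⟨v, hv, rfl⟩, le_refl v⟩
    · rintro ⟨_, ⟨v', hv', rfl⟩, hle⟩
      exact S₀.monotone hle hv'
  rw [hsup, map_sSup, orderHom_sSup_iff] at hS₀
  obtain ⟨_, ⟨_, ⟨v, hv, rfl⟩, rfl⟩, hw⟩ := hS₀
  refine ⟨v, fun S => ⟨fun hS => ?_, fun hS => ?_⟩⟩
  · exact (orderHom_sInf_iff _ _).1 hv S hS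
  · exact OrderHomClass.mono h (principal_le_iff.2 hS) w hw

instance : complexAlgebra.{u}.Full := by
  refine ⟨fun {X Y} h => ?_⟩
  choose φ hφ using exists_forall_completeLatticeHom_iff
    (W := Y.unop.carrier) (W' := X.unop.carrier) h.toFun
  let f : Y.unop ⟶ X.unop :=
    { toFun := ⟨φ, fun w w' hw =>
        (hφ w' (principal (φ w))).1 ((h.toFun (principal (φ w))).monotone hw
          ((hφ w (principal (φ w))).2 (le_refl _)))⟩
      map_rel := fun {w v} hwv => by
        -- The successors of `φ w`: trivially `φ w ∈ □ S`, so the lax inequality sends every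
        -- successor `v` of `w` to `φ v ∈ S`.
        let S : X.unop.carrier →o Prop :=
          ⟨X.unop.rel (φ w), fun _ _ hle hr => X.unop.rel_of_le le_rfl hr hle⟩
        exact (hφ v S).1 (h.map_box_le S w
          ((hφ w (boxOp X.unop S)).2 fun _ hx => hx) v hwv) }
  refine ⟨f.op, PrAlgLattO.Hom.ext (DFunLike.ext _ _ fun S => orderHom_ext fun w => (hφ w S).symm)⟩

/-! ## The frame of prime elements -/

namespace PrAlgLattO

/-- An isomorphism of prime algebraic lattices with operators built from an order isomorphism which commutes
with the operators. -/
def isoMk {L L' : PrAlgLattO.{u}} (e : L.carrier ≃o L'.carrier)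
    (he : ∀ x, e (L.box x) = L'.box (e x)) : L ≅ L' where
  hom := ⟨e, fun x => (he x).le⟩
  inv := ⟨e.symm, fun x => by
    change e.symm (L'.box x) ≤ L.box (e.symm x)
    rw [e.symm_apply_le, he, e.apply_symm_apply]⟩
  hom_inv_id := Hom.ext (DFunLike.ext _ _ e.symm_apply_apply)
  inv_hom_id := Hom.ext (DFunLike.ext _ _ e.apply_symm_apply)

section Iso

variable {L L' : PrAlgLattO.{u}} (i : L ≅ L')

theorem inv_hom_apply (x : L.carrier) : i.inv.toFun (i.hom.toFun x) = x :=
  DFunLike.congr_fun (congrArg Hom.toFun i.hom_inv_id) x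

theorem hom_inv_apply (x : L'.carrier) : i.hom.toFun (i.inv.toFun x) = x :=
  DFunLike.congr_fun (congrArg Hom.toFun i.inv_hom_id) x

theorem le_hom_iff (x : L.carrier) (y : L'.carrier) : y ≤ i.hom.toFun x ↔ i.inv.toFun y ≤ x :=
  ⟨fun h => (OrderHomClass.mono i.inv.toFun h).trans (inv_hom_apply i x).le,
    fun h => (hom_inv_apply i y).ge.trans (OrderHomClass.mono i.hom.toFun h)⟩

/-- An isomorphism is an order isomorphism, and the lax box inequality for its inverse is the
missing half of the equality. -/
theorem heytInj_hom : heytInj i.hom := by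
  refine ⟨fun a b e he c => ?_, fun x => le_antisymm (i.hom.map_box_le x) ?_,
    Function.LeftInverse.injective (inv_hom_apply i)⟩
  · rw [le_hom_iff, le_hom_iff, map_inf, inv_hom_apply]
    exact he _
  · rw [le_hom_iff]
    exact (i.inv.map_box_le _).trans (congrArg L.box (inv_hom_apply i x)).le

theorem heyt_hom : heyt i.hom := ⟨(heytInj_hom i).1, (heytInj_hom i).2.1⟩

end Iso

/-- The frame of prime elements of a prime algebraic lattice with an operator, in the reversed
order. -/
def primeFrame (L : PrAlgLattO.{u}) : EBimod.{u} where
  -- The order is reversed because a larger point has a smaller principal upper set.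
  carrier := {p : L.carrier // IsPrimeElement p}ᵒᵈ
  -- Equivalently, `q` lies below the value at `p` of the left adjoint of `L.box`.
  rel p q := ∀ x, (OrderDual.ofDual p).1 ≤ L.box x → (OrderDual.ofDual q).1 ≤ x
  rel_of_le {_ _ _ _} hp h hq x hx := le_trans hq (h x (le_trans hp hx))

/-- The prime elements below `x` form an upper set of the frame of primes. -/
def primesBelow (L : PrAlgLattO.{u}) (x : L.carrier) : L.primeFrame.carrier →o Prop :=
  ⟨fun p => (OrderDual.ofDual p).1 ≤ x, fun _ _ h hp => le_trans h hp⟩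

theorem le_iff_forall_prime (L : PrAlgLattO.{u}) {x y : L.carrier} :
    x ≤ y ↔ ∀ p : L.carrier, IsPrimeElement p → p ≤ x → p ≤ y :=
  ⟨fun h _ _ hp => hp.trans h, fun h => by
    rw [L.primeAlgebraic x]
    exact sSup_le fun p hp => h p hp.2 hp.1⟩

/-- A prime algebraic lattice is isomorphic to the lattice of upper sets of its frame of primes. -/
def primesBelowIso (L : PrAlgLattO.{u}) : L.carrier ≃o (L.primeFrame.carrier →o Prop) where
  toFun := L.primesBelow
  invFun S := sSup {p | ∃ hp : IsPrimeElement p, S (OrderDual.toDual ⟨p, hp⟩)}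
  left_inv x := by
    refine Eq.trans (congrArg sSup ?_) (L.primeAlgebraic x).symm
    ext p
    exact ⟨fun ⟨hp, h⟩ => ⟨h, hp⟩, fun ⟨h, hp⟩ => ⟨hp, h⟩⟩
  right_inv S := by
    ext p
    constructor
    · intro h
      -- Primality puts `p` below a single member of the join.
      obtain ⟨q, ⟨hq, hS⟩, hle⟩ := (OrderDual.ofDual p).2 _ h
      exact S.monotone (a := OrderDual.toDual ⟨q, hq⟩) (b := p) hle hS
    · exact fun h => le_sSup ⟨(OrderDual.ofDual p).2, h⟩
  map_rel_iff' := by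
    intro x y
    exact ⟨fun h => (le_iff_forall_prime L).2 fun p hp => h (OrderDual.toDual ⟨p, hp⟩),
      fun h p hp => le_trans hp h⟩

theorem primesBelow_box (L : PrAlgLattO.{u}) (x : L.carrier) :
    L.primesBelow (L.box x) = boxOp L.primeFrame (L.primesBelow x) := by
  ext p
  refine ⟨fun h q hq => hq x h, fun h => ?_⟩
  -- The left adjoint of `L.box` at `p`. As box preserves meets, `p ≤ L.box y`, and the primes below
  -- `y` are successors of `p`, so they lie below `x`.
  let y : L.carrier := sInf {y | (OrderDual.ofDual p).1 ≤ L.box y}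
  have hy : (OrderDual.ofDual p).1 ≤ L.box y := by
    rw [map_sInf]
    refine le_sInf ?_
    rintro _ ⟨z, hz, rfl⟩
    exact hz
  have hyx : y ≤ x := (le_iff_forall_prime L).2 fun q hq hqy =>
    h (OrderDual.toDual ⟨q, hq⟩) fun z hz => hqy.trans (sInf_le hz)
  exact hy.trans (OrderHomClass.mono L.box hyx)

/-- A prime algebraic lattice with an operator is isomorphic to the complex algebra of its frame
of primes. -/
def isoComplexAlgebra (L : PrAlgLattO.{u}) : complexAlgebra.obj (op L.primeFrame) ≅ L :=
  (isoMk (L' := complexAlgebra.obj (op L.primeFrame)) L.primesBelowIso L.primesBelow_box).symm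

end PrAlgLattO

instance : complexAlgebra.{u}.EssSurj := ⟨fun L => ⟨op L.primeFrame, ⟨L.isoComplexAlgebra⟩⟩⟩

instance : complexAlgebra.{u}.IsEquivalence where

end ModalDuality

/-- The complex algebra functor from the opposite of the category of modal Kripke frames to the
category of prime algebraic lattices with an operator is an equivalence, and it restricts to
equivalences between the two pairs of wide subcategories. -/
theorem mainTheorem4 :
    ModalDuality.complexAlgebra.{u}.IsEquivalence ∧
    (∃ E : (WideSubcategory ModalDuality.EBimod.moo.{u})ᵒᵖ ≌
        WideSubcategory ModalDuality.PrAlgLattO.heyt.{u},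
      E.functor ⋙ wideSubcategoryInclusion ModalDuality.PrAlgLattO.heyt.{u} =
        (wideSubcategoryInclusion ModalDuality.EBimod.moo.{u}).op ⋙
          ModalDuality.complexAlgebra.{u}) ∧
    (∃ E : (WideSubcategory ModalDuality.EBimod.mooSurj.{u})ᵒᵖ ≌
        WideSubcategory ModalDuality.PrAlgLattO.heytInj.{u},
      E.functor ⋙ wideSubcategoryInclusion ModalDuality.PrAlgLattO.heytInj.{u} =
        (wideSubcategoryInclusion ModalDuality.EBimod.mooSurj.{u}).op ⋙
          ModalDuality.complexAlgebra.{u}) := by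
  open ModalDuality in
  exact ⟨inferInstance,
    exists_wideSubcategory_equivalence _ _ _
      (fun f => and_congr (preservesExponentials_map_iff f) (commutesWithBox_map_iff f))
      PrAlgLattO.heyt_hom,
    exists_wideSubcategory_equivalence _ _ _
      (fun f => and_congr (preservesExponentials_map_iff f)
        (and_congr (commutesWithBox_map_iff f) (injective_map_iff f)))
      PrAlgLattO.heytInj_hom⟩
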